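/- **Setting.** Let $G$ be a map on an orientable surface of genus $g\ge 0$: a finite graph with at least one edge, embedded on a closed connected oriented surface so that every face is an open disk (loops and multiple edges, contractible or not, are allowed; $n-m+f=2-2g$). An *angle labeling* assigns to every face corner of $G$ a label in $\mathbb Z_3$. It is an *edge angle labeling* if for every edge $e$ the labels of the four angles incident to $e$ are either all equal to some $i$ (type 0), or, in clockwise order around $e$, $i-1,i,i,i+1$ for some $i\in\mathbb Z_3$, where the two angles labeled $i$ are incident to the same end of $e$ (type 1) or to the same side of $e$ (type 2). The *primal-dual completion* $\hat G$ is the map obtained by embedding $G$ and its dual $G^*$ simultaneously, every edge crossing its dual edge in one point, which becomes a vertex (an edge-vertex) of degree four; its other vertices are the vertices of $G$ (primal-vertices) and of $G^*$ (dual-vertices), and its faces correspond to the angles of $G$. An edge angle labeling defines an orientation of $\hat G$: if an edge has type 0, all four edges of $\hat G$ at its edge-vertex leave the edge-vertex; if it has type 1 or 2, the only edge leaving the edge-vertex is the one between the two angles labeled $i$. The orientations of $\hat G$ obtained in this way are the *Schnyder orientations*. *Homology.* Fix reference directions of the edges of a map $M$. A closed walk $W$ has the characteristic flow $\phi(W)\in\mathbb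 Z^{E(M)}$ (number of forward minus number of backward traversals of each edge); similarly for oriented subgraphs. Let $\mathbb W$ be the group generated by the flows of all closed walks and $\mathbb F$ the group generated by the flows $\phi(F)$ of the counterclockwise facial walks $F$. Cycles $B_1,\dots,B_{2g}$ of a map of genus $g$, each with a direction of traversal, form a *basis for the homology* if their classes generate $\mathbb W/\mathbb F$. *Type.* For an orientation of $\hat G$ and a cycle $C$ of $G$ with a direction of traversal, let $\hat C$ be the corresponding cycle of $\hat G$ and let $\gamma(C)$ be the number of edges of $\hat G$ leaving $\hat C$ on its right minus the number of edges leaving $\hat C$ on its left. Two orientations of $\hat G$ have the *same type* with respect to a basis $B_1,\dots,B_{2g}$ for the homology of $G$ if they have the same value $\gamma(B_i)$ for every $i$. *Order.* Let $f_0$ be a face of $\hat G$. For orientations $D,D'$ of $\hat G$ let $D\setminus D'$ be the oriented subgraph of $D$ formed by the edges that are oriented differently in $D'$. Write $D\le_{f_0}D'$ if $\phi(D\setminus D')=\sum_{F}\lambda_F\,\phi(F)$, the sum being over the counterclockwise facial walks $F$ of $\hat G$ other than that of $f_0$, with all $\lambda_F\in\mathbb N=\{0,1,2,\dots\}$. **Theorem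 4.14.** Let $G$ be a map on an orientable surface of genus $g$, let $D_0$ be a Schnyder orientation of $\hat G$, let $f_0$ be a face of $\hat G$, and let $B_1,\dots,B_{2g}$ be any cycles of $G$ that form a basis for the homology. Let $S(\hat G,D_0)$ be the set of all Schnyder orientations of $\hat G$ that have the same outdegree as $D_0$ at every vertex and the same type as $D_0$ with respect to this basis. Then $(S(\hat G,D_0),\le_{f_0})$ is a distributive lattice (in particular $\le_{f_0}$ is a partial order on it). -/

import Mathlib

noncomputable section

/-- A (finite, when `δ` is finite) map on a connected closed oriented surface, i.e. a graph
embedded so that all faces are open disks, encoded as usual by its darts (edges with a direction of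
traversal): `rev` reverses a dart, and `next d` is the dart following `d` in counterclockwise
order around the starting vertex of `d`. The graph is connected, since the faces are disks. -/
structure SurfaceMap (δ : Type*) where
  next : Equiv.Perm δ
  rev : Equiv.Perm δ
  rev_rev : ∀ d, rev (rev d) = d
  rev_ne : ∀ d, rev d ≠ d
  connected : ∀ a b : δ, ∃ g ∈ Subgroup.closure {next, rev}, g a = b

namespace SurfaceMap

variable {δ : Type*} (M : SurfaceMap δ)

/-- The dart following `d` on the boundary of the face to the left of `d` (that boundary is then
traversed counterclockwise, with the face on the left). -/
def faceNext : Equiv.Perm δ := M.next⁻¹ * M.rev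

/-- Vertices: orbits of `next`. -/
def Vertex : Type _ := Quotient (Equiv.Perm.SameCycle.setoid M.next)

/-- Edges: orbits of `rev`. -/
def Edge : Type _ := Quotient (Equiv.Perm.SameCycle.setoid M.rev)

/-- Faces: orbits of `faceNext`. -/
def Face : Type _ := Quotient (Equiv.Perm.SameCycle.setoid M.faceNext)

instance [Finite δ] : Finite M.Vertex := inferInstanceAs (Finite (Quotient _))
instance [Finite δ] : Finite M.Edge := inferInstanceAs (Finite (Quotient _))
instance [Finite δ] : Finite M.Face := inferInstanceAs (Finite (Quotient _))
instance [Finite δ] : Fintype M.Face := Fintype.ofFinite _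

/-- The vertex at which a dart starts. -/
def tail (d : δ) : M.Vertex := Quotient.mk _ d

/-- The vertex at which a dart ends. -/
def head (d : δ) : M.Vertex := M.tail (M.rev d)

/-- The face to the left of a dart. -/
def leftFace (d : δ) : M.Face := Quotient.mk _ d

/-- The surface has genus `g`, by Euler's formula. -/
def HasGenus (g : ℕ) : Prop :=
  (Nat.card M.Vertex : ℤ) - Nat.card M.Edge + Nat.card M.Face = 2 - 2 * g

/-! ### Flows and homology

A flow assigns to every edge an integer, relative to a reference direction of the edge. Without
choosing reference directions, it is a function `φ` on darts with `φ (rev d) = -φ d`: the value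
`φ d` is the coordinate of the edge of `d` when `d` is taken as its reference direction. All
flows defined below have this property. -/

/-- The characteristic flow of a set of darts (of an oriented subgraph). -/
def setFlow (T : Set δ) (d : δ) : ℤ :=
  open Classical in (if d ∈ T then 1 else 0) - (if M.rev d ∈ T then 1 else 0)

/-- The characteristic flow of a sequence of darts: the number of forward traversals minus the
number of backward traversals. -/
def walkFlow {k : ℕ} (w : Fin k → δ) (d : δ) : ℤ :=
  (Nat.card {i // w i = d} : ℤ) - Nat.card {i // w i = M.rev d}

/-- The sequence of darts `w` is a closed walk. -/
def IsClosedWalk {k : ℕ} (w : Fin k → δ) : Prop :=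
  ∀ i, M.head (w i) = M.tail (w (finRotate k i))

/-- The characteristic flow of the counterclockwise facial walk of `F`; this walk traverses once
each dart that has `F` on its left. -/
def faceFlow (F : M.Face) : δ → ℤ := M.setFlow {d | M.leftFace d = F}

/-- The group generated by the facial walks. -/
def faceGroup : AddSubgroup (δ → ℤ) := AddSubgroup.closure (Set.range M.faceFlow)

/-- The group generated by the closed walks. The first homology group of the map is the quotient
of `closedWalkGroup` by `faceGroup`. -/
def closedWalkGroup : AddSubgroup (δ → ℤ) :=
  AddSubgroup.closure {φ | ∃ (k : ℕ) (w : Fin k → δ), M.IsClosedWalk w ∧ φ = M.walkFlow w}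

/-- A cycle of the graph together with a direction of traversal: a nonempty closed walk without
repeated vertices or edges. -/
structure DirCycle where
  length : ℕ
  length_pos : 0 < length
  dart : Fin length → δ
  closed : M.IsClosedWalk dart
  tail_injective : Function.Injective fun i => M.tail (dart i)
  ne_rev : ∀ i j, dart i ≠ M.rev (dart j)

/-- The `2g` cycles `B` form a basis for the homology of the map of genus `g`: their classes
generate the quotient of `closedWalkGroup` by `faceGroup`. -/
def IsHomologyBasis {g : ℕ} (B : Fin (2 * g) → M.DirCycle) : Prop :=
  M.faceGroup ⊔ AddSubgroup.closure (Set.range fun i => M.walkFlow (B i).dart) =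
    M.closedWalkGroup

/-! ### Orientations -/

/-- An orientation of the map selects exactly one of the two darts of each edge. -/
@[ext]
structure Orientation where
  darts : Set δ
  rev_mem_iff : ∀ d, M.rev d ∈ darts ↔ d ∉ darts

variable {M} in
/-- The number of edges leaving a vertex. -/
def Orientation.outdegree (D : M.Orientation) (v : M.Vertex) : ℕ :=
  {d | d ∈ D.darts ∧ M.tail d = v}.ncard

variable {M} in
/-- The order given by the face `f₀`: the oriented subgraph `D \ D'` formed by the edges of `D`
that are oriented differently in `D'` is counterclockwise, i.e. its characteristic flow is a
combination with coefficients in `ℕ` of the counterclockwise facial walks of the faces other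
than `f₀`. -/
def Orientation.FaceLE [Finite δ] (f₀ : M.Face) (D D' : M.Orientation) : Prop :=
  ∃ c : M.Face → ℕ, c f₀ = 0 ∧ M.setFlow (D.darts \ D'.darts) = ∑ F, (c F : ℤ) • M.faceFlow F

/-- For two darts `a ≠ b` starting at the same vertex, the darts strictly after `a` and strictly
before `b` in counterclockwise order around that vertex. -/
def sector (a b : δ) : Set δ :=
  {x | ∃ n : ℕ, 0 < n ∧ (M.next ^ n) a = x ∧ ∀ m : ℕ, 0 < m → m ≤ n → (M.next ^ m) a ≠ b}

variable {M} in
/-- The contribution to `γ` of one vertex of a directed cycle that reaches this vertex by the dart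
`rev b` and leaves it by the dart `a`: the number of edges leaving the cycle at this vertex on
its right minus the number of those leaving the cycle at this vertex on its left. -/
def Orientation.turn (D : M.Orientation) (b a : δ) : ℤ :=
  ((D.darts ∩ M.sector b a).ncard : ℤ) - (D.darts ∩ M.sector a b).ncard

end SurfaceMap

/-! ### The primal-dual completion -/

/-- The darts of the primal-dual completion of a map with set of darts `δ`.
* `primal d`: from the primal-vertex `tail d` to the edge-vertex of the edge of `d`.
* `dual d`: from the dual-vertex of `leftFace d` to the edge-vertex of the edge of `d`,
  reaching it on the left side of `d`.
* `toPrimal d`, `toDual d`: the reverses of `primal d`, `dual d`. -/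
inductive PDart (δ : Type*) : Type _
  | primal (d : δ)
  | dual (d : δ)
  | toPrimal (d : δ)
  | toDual (d : δ)

namespace PDart

variable {δ : Type*}

instance [Finite δ] : Finite (PDart δ) :=
  Finite.of_injective
    (fun x : PDart δ => match x with
      | primal d => (d, (0 : Fin 4))
      | dual d => (d, 1)
      | toPrimal d => (d, 2)
      | toDual d => (d, 3))
    (by rintro (a | a | a | a) (b | b | b | b) h <;> simp_all)

/-- The reverse of a dart. -/
def reverse : PDart δ → PDart δ
  | primal d => toPrimal d
  | dual d => toDual d
  | toPrimal d => primal d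
  | toDual d => dual d

theorem reverse_reverse (x : PDart δ) : x.reverse.reverse = x := by
  cases x <;> rfl

/-- Reversal of darts in the primal-dual completion, as a permutation. -/
def reversePerm : Equiv.Perm (PDart δ) where
  toFun := reverse
  invFun := reverse
  left_inv := reverse_reverse
  right_inv := reverse_reverse

end PDart

namespace SurfaceMap

open PDart

variable {δ : Type*} (G : SurfaceMap δ)

/-- Counterclockwise rotation in the primal-dual completion. At a primal-vertex it is that of `G`;
around a dual-vertex the edges appear as on the counterclockwise boundary of the face; around
the edge-vertex of `d` one meets, counterclockwise, the end of `d`, the face to the left of `d`,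
the start of `d`, the face to the right of `d`. -/
def pdcNext : Equiv.Perm (PDart δ) where
  toFun
    | primal d => primal (G.next d)
    | dual d => dual (G.faceNext d)
    | toPrimal d => toDual (G.rev d)
    | toDual d => toPrimal d
  invFun
    | primal d => primal (G.next⁻¹ d)
    | dual d => dual (G.faceNext⁻¹ d)
    | toPrimal d => toDual d
    | toDual d => toPrimal (G.rev d)
  left_inv x := by cases x <;> simp [G.rev_rev]
  right_inv x := by cases x <;> simp [G.rev_rev]

theorem pdc_connected (a b : PDart δ) :
    ∃ g ∈ Subgroup.closure {G.pdcNext, reversePerm}, g a = b := by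
  set H := Subgroup.closure {G.pdcNext, reversePerm} with hH
  have hn : G.pdcNext ∈ H := Subgroup.subset_closure (by simp)
  have hr : reversePerm ∈ H := Subgroup.subset_closure (by simp)
  let R : PDart δ → PDart δ → Prop := fun a b => ∃ g ∈ H, g a = b
  have symm : ∀ {a b}, R a b → R b a := by
    rintro a b ⟨g, hg, rfl⟩
    exact ⟨g⁻¹, H.inv_mem hg, by simp⟩
  have trans : ∀ {a b c}, R a b → R b c → R a c := by
    rintro a b c ⟨g, hg, rfl⟩ ⟨h, hh, rfl⟩
    exact ⟨h * g, H.mul_mem hh hg, rfl⟩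
  have sn : ∀ a, R a (G.pdcNext a) := fun a => ⟨_, hn, rfl⟩
  have sr : ∀ a, R a (reversePerm a) := fun a => ⟨_, hr, rfl⟩
  have key : ∀ g ∈ Subgroup.closure {G.next, G.rev}, ∀ d, R (primal d) (primal (g d)) := by
    intro g hg
    induction hg using Subgroup.closure_induction with
    | mem x hx =>
      intro d
      rcases hx with rfl | rfl
      · exact sn (primal d)
      · exact trans (sr (primal d)) (trans (sn (toPrimal d)) (trans (sn (toDual (G.rev d)))
          (sr (toPrimal (G.rev d)))))
    | one => exact fun d => ⟨1, H.one_mem, rfl⟩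
    | mul x y _ _ hx hy => exact fun d => trans (hy d) (hx (y d))
    | inv x _ hx =>
      intro d
      have := hx (x⁻¹ d)
      have h : x (x⁻¹ d) = d := x.apply_symm_apply d
      rw [h] at this
      exact symm this
  have base : ∀ a, ∃ d, R a (primal d) := by
    rintro (d | d | d | d)
    · exact ⟨d, 1, H.one_mem, rfl⟩
    · exact ⟨d, trans (sr (dual d)) (trans (sn (toDual d)) (sr (toPrimal d)))⟩
    · exact ⟨d, sr (toPrimal d)⟩
    · exact ⟨d, trans (sn (toDual d)) (sr (toPrimal d))⟩
  obtain ⟨d, hd⟩ := base a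
  obtain ⟨e, he⟩ := base b
  obtain ⟨g, hg, rfl⟩ := G.connected d e
  exact trans hd (trans (key g hg d) (symm he))

/-- The primal-dual completion of `G`. -/
def pdc : SurfaceMap (PDart δ) where
  next := G.pdcNext
  rev := reversePerm
  rev_rev := reverse_reverse
  rev_ne x := by cases x <;> simp [reversePerm, reverse]
  connected := G.pdc_connected

/-! ### Angle labelings and Schnyder orientations

The angle (face corner) of `G` between the consecutive darts `d` and `next d` is denoted by `d`; it
lies at the start of `d`, on the left side of `d`. The four angles incident to the edge of `d`
are, in clockwise order around the edge: `d` (start of `d`, left), `faceNext d` (end of `d`,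
left), `rev d` (end of `d`, right), `faceNext (rev d)` (start of `d`, right). -/

/-- The edge of `d` is of type 0: its four angles have the same label. -/
def EdgeType0 (l : δ → ZMod 3) (d : δ) : Prop :=
  ∃ i, l d = i ∧ l (G.faceNext d) = i ∧ l (G.rev d) = i ∧ l (G.faceNext (G.rev d)) = i

/-- The edge of `d` is of type 1, the two angles with the same label being incident to the
start of `d`: the labels are `i-1, i, i, i+1` in clockwise order. -/
def EdgeType1 (l : δ → ZMod 3) (d : δ) : Prop :=
  ∃ i, l (G.rev d) = i - 1 ∧ l (G.faceNext (G.rev d)) = i ∧ l d = i ∧ l (G.faceNext d) = i + 1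

/-- The edge of `d` is of type 2, the two angles with the same label being incident to the
left side of `d`: the labels are `i-1, i, i, i+1` in clockwise order. -/
def EdgeType2 (l : δ → ZMod 3) (d : δ) : Prop :=
  ∃ i, l (G.faceNext (G.rev d)) = i - 1 ∧ l d = i ∧ l (G.faceNext d) = i ∧ l (G.rev d) = i + 1

/-- The angle labeling `l` is an edge angle labeling (a Schnyder labeling): every edge is of
type 0, 1 or 2. -/
def IsEdgeLabeling (l : δ → ZMod 3) : Prop :=
  ∀ d, G.EdgeType0 l d ∨ (G.EdgeType1 l d ∨ G.EdgeType1 l (G.rev d)) ∨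
    (G.EdgeType2 l d ∨ G.EdgeType2 l (G.rev d))

/-- The orientation `D` of the primal-dual completion corresponds to the labeling `l`. If an edge is
of type 0, all four edges at its edge-vertex leave the edge-vertex. If it is of type 1 or 2, the
only edge leaving its edge-vertex is the one between the two angles with the same label; it goes
to a primal-vertex for type 1 and to a dual-vertex for type 2. -/
def Corresponds (l : δ → ZMod 3) (D : G.pdc.Orientation) : Prop :=
  ∀ d,
    (G.EdgeType0 l d → toPrimal d ∈ D.darts ∧ toPrimal (G.rev d) ∈ D.darts ∧
      toDual d ∈ D.darts ∧ toDual (G.rev d) ∈ D.darts) ∧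
    (G.EdgeType1 l d → toPrimal d ∈ D.darts ∧ toPrimal (G.rev d) ∉ D.darts ∧
      toDual d ∉ D.darts ∧ toDual (G.rev d) ∉ D.darts) ∧
    (G.EdgeType2 l d → toPrimal d ∉ D.darts ∧ toPrimal (G.rev d) ∉ D.darts ∧
      toDual d ∈ D.darts ∧ toDual (G.rev d) ∉ D.darts)

/-- Schnyder orientations of the primal-dual completion. -/
def IsSchnyder (D : G.pdc.Orientation) : Prop :=
  ∃ l : δ → ZMod 3, G.IsEdgeLabeling l ∧ G.Corresponds l D

variable {G} in
/-- `γ(C)` for a directed cycle `C` of `G`: the number of edges of the primal-dual completion leaving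
the cycle that corresponds to `C` on its right minus the number of those leaving it on its left.
The cycle corresponding to `C` goes, for each dart `d` of `C`, along `primal d` to an edge-vertex,
then along `toPrimal (rev d)`. The first summand is for the primal-vertex at the end of a dart and
at the start of the following one, the second summand for the edge-vertex. -/
def gamma (D : G.pdc.Orientation) (C : G.DirCycle) : ℤ :=
  ∑ i, (D.turn (primal (G.rev (C.dart i))) (primal (C.dart (finRotate C.length i))) +
    D.turn (toPrimal (C.dart i)) (toPrimal (G.rev (C.dart i))))

/-- The Schnyder orientations with the same outdegrees as `D₀` and the same type as `D₀` with
respect to the homology basis `B`. -/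
def schnyderClass {g : ℕ} (B : Fin (2 * g) → G.DirCycle) (D₀ : G.pdc.Orientation) :
    Set G.pdc.Orientation :=
  {D | G.IsSchnyder D ∧ (∀ v, D.outdegree v = D₀.outdegree v) ∧
    ∀ i, gamma D (B i) = gamma D₀ (B i)}

end SurfaceMap

end

/-! Call `h`, a function on the faces of Ĝ, a height of `D'` over `D` if crossing any dart from
right to left changes `h` by the difference of the two indicators (`IsHeight`). The proof has two
halves. The class is a homology class (`mem_schnyderClass_iff`). Equal outdegrees let the difference
of two orientations be integrated around each vertex, which gives a local height `V` on the corners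
there. The mismatch of `V` along the edges of G is an antisymmetric form (`residualForm`). It sums
to zero around every face of G, and its sum along a cycle is half the difference of the two values
of γ (`gamma_sub_gamma`). Equal type therefore makes it vanish on a homology basis, hence on all
closed walks; it is then a coboundary, and shifting `V` at each vertex of G gives a global height
(`exists_isHeight`). Conversely, a height forces equal outdegrees and equal γ, and subtracting it
mod 3 turns a Schnyder labeling of one orientation into one of the other (`IsSchnyder.of_isHeight`).
A homology class is a lattice (`exists_distribLattice_faceLE`). A height normalized to 0 at `f₀`
determines its orientation and is determined by it. Heights are exactly the functions satisfying
upper bounds on differences, a condition stable under pointwise max and min, and the order becomes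
the pointwise order. -/

noncomputable section

/-! ### Integration of increments, in general and along the cycles of a permutation. -/

open scoped Classical in
/-- If the increments `P a b n` from `a` to `b` compose and reverse, and all increments from a
point to itself vanish, then they are the differences of a potential. -/
theorem exists_potential_of_increments {α : Type*} (P : α → α → ℤ → Prop)
    (refl : ∀ a, P a a 0) (symm : ∀ a b n, P a b n → P b a (-n))
    (trans : ∀ a b c m n, P a b m → P b c n → P a c (m + n))
    (loop : ∀ a n, P a a n → n = 0) :
    ∃ ν : α → ℤ, ∀ a b n, P a b n → ν b - ν a = n := by
  let s : Setoid α :=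
    { r := fun a b => ∃ n, P a b n
      iseqv := ⟨fun a => ⟨0, refl a⟩, fun ⟨n, h⟩ => ⟨-n, symm _ _ _ h⟩,
        fun ⟨m, h⟩ ⟨n, h'⟩ => ⟨m + n, trans _ _ _ _ _ h h'⟩⟩ }
  -- The chosen representative of each class serves as its base point; `ν` is the increment from
  -- there.
  have h : ∀ a : α, ∃ n, P (Quotient.out (Quotient.mk s a)) a n := fun a => Quotient.mk_out (s := s) a
  choose ν hν using h
  refine ⟨ν, fun a b n hab => ?_⟩
  have e : Quotient.mk s a = Quotient.mk s b := Quotient.sound ⟨n, hab⟩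
  have hb := hν b
  rw [← e] at hb
  have := loop _ _ (trans _ _ _ _ _ (trans _ _ _ _ _ (hν a) hab) (symm _ _ _ hb))
  linarith

namespace Equiv.Perm

variable {α : Type*} (σ : Equiv.Perm α) (f : α → ℤ)

/-- The sum of `f` vanishes along every closed trajectory of `σ`. -/
def SumZeroOnCycles : Prop :=
  ∀ (k : ℕ) (x : α), (σ ^ k) x = x → ∑ i ∈ Finset.range k, f ((σ ^ i) x) = 0

variable {σ f}

-- If `σ ^ k` fixes one point of a cycle it fixes all of them, so the sum over `k` steps does not
-- depend on the starting point. Averaged over the cycle it is `k` times the total sum, hence zero.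
open scoped Classical in
theorem sumZeroOnCycles_of_sum_sameCycle [Fintype α]
    (h : ∀ a, ∑ x with σ.SameCycle a x, f x = 0) : SumZeroOnCycles σ f := by
  intro k a hk
  set g : α → ℤ := fun x => ∑ i ∈ Finset.range k, f ((σ ^ i) x) with hg
  have hper : ∀ x, σ.SameCycle a x → (σ ^ k) x = x := by
    rintro x ⟨n, rfl⟩
    rw [← Equiv.Perm.mul_apply, ← zpow_natCast, ← zpow_add, add_comm, zpow_add,
      Equiv.Perm.mul_apply, zpow_natCast, hk]
  have hstep : ∀ x, σ.SameCycle a x → g (σ x) = g x := by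
    intro x hx
    have h1 : g (σ x) = ∑ i ∈ Finset.range k, f ((σ ^ (i + 1)) x) := by
      simp only [hg, pow_succ, Equiv.Perm.mul_apply]
    have h2 := Finset.sum_range_succ' (fun i => f ((σ ^ i) x)) k
    rw [Finset.sum_range_succ, hper x hx] at h2
    simp only [pow_zero, Equiv.Perm.one_apply] at h2
    rw [h1]
    simp only [hg]
    linarith
  have hconst : ∀ x, σ.SameCycle a x → g x = g a := by
    intro x hx
    obtain ⟨n, -, rfl⟩ := hx.exists_pow_eq'
    clear hx
    induction n with
    | zero => simp
    | succ n ih =>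
      rw [pow_succ', Equiv.Perm.mul_apply, hstep _ ⟨n, by simp⟩, ih]
  have hsum : ∑ x with σ.SameCycle a x, g x = 0 := by
    simp only [hg]
    rw [Finset.sum_comm]
    refine Finset.sum_eq_zero fun i _ => ?_
    rw [← h a]
    refine Finset.sum_equiv (σ ^ i) (fun x => ?_) (fun x _ => rfl)
    simp [Equiv.Perm.sameCycle_pow_right]
  rw [Finset.sum_congr rfl (fun x hx => hconst x (by simpa using hx)), Finset.sum_const,
    nsmul_eq_mul, mul_eq_zero] at hsum
  rcases hsum with h0 | h0
  · rw [Nat.cast_eq_zero, Finset.card_eq_zero, Finset.filter_eq_empty_iff] at h0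
    exact absurd (Equiv.Perm.SameCycle.refl σ a) (h0 (Finset.mem_univ a))
  · exact h0

theorem SumZeroOnCycles.exists_potential [Finite α] (h : SumZeroOnCycles σ f) :
    ∃ ν : α → ℤ, ∀ x, ν (σ x) - ν x = f x := by
  have comp : ∀ (j k : ℕ) (a : α), ∑ i ∈ Finset.range (j + k), f ((σ ^ i) a) =
      ∑ i ∈ Finset.range j, f ((σ ^ i) a) + ∑ i ∈ Finset.range k, f ((σ ^ i) ((σ ^ j) a)) := by
    intro j k a
    rw [Finset.sum_range_add]
    simp only [add_comm j, pow_add, Equiv.Perm.mul_apply]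
  obtain ⟨ν, hν⟩ := exists_potential_of_increments
    (fun a b n => ∃ k : ℕ, (σ ^ k) a = b ∧ ∑ i ∈ Finset.range k, f ((σ ^ i) a) = n)
    (fun a => ⟨0, by simp⟩)
    (by
      rintro a b n ⟨k, rfl, rfl⟩
      -- A step backwards is replaced by going on forwards to a multiple of the order of `σ`, which
      -- closes the trajectory.
      obtain ⟨j, hj⟩ : ∃ j, k + j = k * orderOf σ :=
        ⟨k * orderOf σ - k, Nat.add_sub_cancel' (Nat.le_mul_of_pos_right _ (orderOf_pos σ))⟩
      have hk : (σ ^ (k + j)) a = a := by simp [hj, mul_comm k, pow_mul, pow_orderOf_eq_one]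
      refine ⟨j, ?_, ?_⟩
      · rw [← Equiv.Perm.mul_apply, ← pow_add, add_comm, hk]
      · have := h _ _ hk
        rw [comp] at this
        linarith)
    (by
      rintro a b c m n ⟨j, rfl, rfl⟩ ⟨k, rfl, rfl⟩
      exact ⟨j + k, by rw [add_comm, pow_add, Equiv.Perm.mul_apply], comp j k a⟩)
    (by
      rintro a n ⟨k, hk, rfl⟩
      exact h k a hk)
  exact ⟨ν, fun x => hν x (σ x) (f x) ⟨1, by simp⟩⟩

end Equiv.Perm

/-! ### Pairing antisymmetric forms with walks and faces. -/

namespace SurfaceMap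

variable {δ : Type*} (M : SurfaceMap δ)

theorem leftFace_faceNext (d : δ) : M.leftFace (M.faceNext d) = M.leftFace d :=
  Quotient.sound ⟨-1, by simp⟩

theorem tail_next (d : δ) : M.tail (M.next d) = M.tail d :=
  Quotient.sound ⟨-1, by simp⟩

theorem next_faceNext (d : δ) : M.next (M.faceNext d) = M.rev d := by
  simp [faceNext]

theorem faceNext_rev (d : δ) : M.faceNext (M.rev d) = M.next⁻¹ d := by
  simp [faceNext, M.rev_rev]

theorem faceNext_rev_next (d : δ) : M.faceNext (M.rev (M.next d)) = d := by
  simp [faceNext_rev]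

/-- Evaluation of an antisymmetric function on a closed walk. -/
theorem sum_walkFlow_mul [Fintype δ] {k : ℕ} (w : Fin k → δ) (ω : δ → ℤ)
    (hω : ∀ d, ω (M.rev d) = -ω d) :
    ∑ d, M.walkFlow w d * ω d = 2 * ∑ i, ω (w i) := by
  classical
  have h1 : ∀ e : δ ≃ δ, ∑ d, (Nat.card {i // w i = e d} : ℤ) * ω d = ∑ i, ω (e.symm (w i)) := by
    intro e
    have : ∀ d, (Nat.card {i // w i = e d} : ℤ) * ω d = ∑ i, if d = e.symm (w i) then ω d else 0 := by
      intro d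
      rw [Nat.subtype_card (Finset.univ.filter fun i => w i = e d) (by simp), ← Finset.sum_boole,
        Finset.sum_mul]
      refine Finset.sum_congr rfl fun i _ => ?_
      have : w i = e d ↔ d = e.symm (w i) := by
        rw [Equiv.eq_symm_apply, eq_comm]
      simp only [this, ite_mul, one_mul, zero_mul]
    rw [Finset.sum_congr rfl fun d _ => this d, Finset.sum_comm]
    simp
  have hrev : ∀ d, M.rev.symm d = M.rev d := fun d => by
    rw [Equiv.symm_apply_eq, M.rev_rev]
  simp only [walkFlow, sub_mul, Finset.sum_sub_distrib]
  have h2 := h1 (Equiv.refl δ)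
  have h3 := h1 M.rev
  simp only [Equiv.refl_apply, Equiv.refl_symm] at h2
  rw [h2, h3]
  simp only [hrev, hω, Finset.sum_neg_distrib]
  ring

-- Both factors are antisymmetric and the sum runs over both darts of each edge, whence the factor
-- 2. An edge with `F` on both sides contributes zero to either side of the equation.
open scoped Classical in
theorem sum_faceFlow_mul [Fintype δ] (F : M.Face) (ω : δ → ℤ)
    (hω : ∀ d, ω (M.rev d) = -ω d) :
    ∑ d, M.faceFlow F d * ω d = 2 * ∑ d with M.leftFace d = F, ω d := by
  have h : ∑ d, (if M.leftFace (M.rev d) = F then 1 else 0) * ω d =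
      -∑ d with M.leftFace d = F, ω d := by
    rw [← Equiv.sum_comp M.rev, Finset.sum_filter, ← Finset.sum_neg_distrib]
    refine Finset.sum_congr rfl fun d _ => ?_
    rw [M.rev_rev, hω]
    split_ifs <;> simp
  simp only [faceFlow, setFlow, Set.mem_ofPred_eq, sub_mul, Finset.sum_sub_distrib]
  rw [h, Finset.sum_filter]
  simp only [ite_mul, one_mul, zero_mul]
  ring

theorem val_finRotate {k : ℕ} (i : Fin k) :
    (finRotate k i : ℕ) = if (i : ℕ) + 1 < k then (i : ℕ) + 1 else 0 := by
  cases k with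
  | zero => exact i.elim0
  | succ n =>
    rw [coe_finRotate]
    simp only [Fin.ext_iff, Fin.val_last]
    have := i.2
    split_ifs <;> omega

/-- The darts in the list form a walk with the given ends. -/
inductive IsWalk : M.Vertex → M.Vertex → List δ → Prop
  | nil (v : M.Vertex) : IsWalk v v []
  | cons (d : δ) {v : M.Vertex} {l : List δ} : IsWalk (M.head d) v l → IsWalk (M.tail d) v (d :: l)

namespace IsWalk

variable {M} {u v w : M.Vertex} {l l' : List δ}

theorem eq_of_nil (h : M.IsWalk u v []) : u = v := by
  cases h
  rfl

theorem append (h : M.IsWalk u v l) (h' : M.IsWalk v w l') : M.IsWalk u w (l ++ l') := by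
  induction h with
  | nil => exact h'
  | cons d _ ih => exact .cons d (ih h')

theorem single (d : δ) : M.IsWalk (M.tail d) (M.head d) [d] := .cons d (.nil _)

theorem reverse (h : M.IsWalk u v l) : M.IsWalk v u (l.reverse.map M.rev) := by
  induction h with
  | nil => exact .nil _
  | cons d _ ih =>
    rw [List.reverse_cons, List.map_append]
    refine ih.append ?_
    have := single (M := M) (M.rev d)
    rwa [head, M.rev_rev] at this

theorem tail_getElem_zero (h : M.IsWalk u v l) (hl : 0 < l.length) : M.tail l[0] = u := by
  cases h with
  | nil => simp at hl
  | cons => rfl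

theorem head_getElem (h : M.IsWalk u v l) (i : ℕ) (hi : i < l.length) :
    (∀ hi' : i + 1 < l.length, M.head l[i] = M.tail l[i + 1]) ∧
      (i + 1 = l.length → M.head l[i] = v) := by
  induction h generalizing i with
  | nil => simp at hi
  | @cons d v l h ih =>
    cases i with
    | zero =>
      refine ⟨fun hi' => ?_, fun hi' => ?_⟩
      · exact (h.tail_getElem_zero (by simpa using hi')).symm
      · have : l = [] := by simpa using hi'
        subst this
        exact h.eq_of_nil
    | succ i =>
      simp only [List.length_cons, add_lt_add_iff_right, List.getElem_cons_succ,
        add_left_inj] at hi ⊢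
      exact ih i hi

theorem isClosedWalk (h : M.IsWalk v v l) : M.IsClosedWalk l.get := by
  intro i
  obtain ⟨h1, h2⟩ := h.head_getElem i i.2
  have hpos : 0 < l.length := i.pos
  have hrot := val_finRotate i
  split_ifs at hrot with hi
  · simp only [List.get_eq_getElem, hrot]
    exact h1 hi
  · simp only [List.get_eq_getElem, hrot]
    rw [h.tail_getElem_zero hpos]
    exact h2 (by have := i.2; omega)

end IsWalk

/-- An antisymmetric function on darts that vanishes on the closed walks is the coboundary of a
function on vertices. -/
theorem exists_vertex_potential [Fintype δ] (ω : δ → ℤ) (hω : ∀ d, ω (M.rev d) = -ω d)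
    (h : ∀ φ ∈ M.closedWalkGroup, ∑ d, φ d * ω d = 0) :
    ∃ μ : M.Vertex → ℤ, ∀ d, μ (M.head d) - μ (M.tail d) = ω d := by
  obtain ⟨μ, hμ⟩ := exists_potential_of_increments
    (fun u v n => ∃ l, M.IsWalk u v l ∧ (l.map ω).sum = n)
    (fun u => ⟨[], .nil u, by simp⟩)
    (by
      rintro u v n ⟨l, hl, rfl⟩
      refine ⟨_, hl.reverse, ?_⟩
      clear hl
      induction l with
      | nil => simp
      | cons d l ih => simp [hω] at ih ⊢; linarith)
    (by
      rintro u v w m n ⟨l, hl, rfl⟩ ⟨l', hl', rfl⟩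
      exact ⟨_, hl.append hl', by simp⟩)
    (by
      rintro v n ⟨l, hl, rfl⟩
      have := h _ (AddSubgroup.subset_closure ⟨_, l.get, hl.isClosedWalk, rfl⟩)
      rw [M.sum_walkFlow_mul _ _ hω] at this
      have e : (l.map ω).sum = ∑ i, ω (l.get i) := by
        simp [Fin.sum_univ_fun_getElem]
      omega)
  exact ⟨μ, fun d => hμ _ _ _ ⟨[d], .single d, by simp⟩⟩

/-- A homomorphism given by pairing with an antisymmetric function vanishes on all closed walks as
soon as it vanishes on the faces and on a basis for the homology. -/
theorem sum_mul_eq_zero_of_mem_closedWalkGroup [Fintype δ] {g : ℕ}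
    {B : Fin (2 * g) → M.DirCycle} (hB : M.IsHomologyBasis B) (ω : δ → ℤ)
    (hω : ∀ d, ω (M.rev d) = -ω d) (hF : ∀ F, ∑ d, M.faceFlow F d * ω d = 0)
    (hC : ∀ i, ∑ j, ω ((B i).dart j) = 0) :
    ∀ φ ∈ M.closedWalkGroup, ∑ d, φ d * ω d = 0 := by
  let pair : (δ → ℤ) →+ ℤ :=
    { toFun := fun φ => ∑ d, φ d * ω d
      map_zero' := by simp
      map_add' := fun φ ψ => by simp [add_mul, Finset.sum_add_distrib] }
  have : M.closedWalkGroup ≤ pair.ker := by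
    rw [← hB, sup_le_iff, faceGroup, AddSubgroup.closure_le, AddSubgroup.closure_le]
    constructor
    · rintro _ ⟨F, rfl⟩
      exact hF F
    · rintro _ ⟨i, rfl⟩
      change ∑ d, M.walkFlow (B i).dart d * ω d = 0
      rw [M.sum_walkFlow_mul _ _ hω, hC, mul_zero]
  exact fun φ hφ => this hφ

end SurfaceMap
end
noncomputable section

namespace SurfaceMap

theorem apply_inv_self {α : Type*} (σ : Equiv.Perm α) (x : α) : σ (σ⁻¹ x) = x :=
  σ.apply_symm_apply x

theorem inv_apply_self {α : Type*} (σ : Equiv.Perm α) (x : α) : σ⁻¹ (σ x) = x :=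
  σ.symm_apply_apply x

/-! ### Heights, outdegrees and turns on an arbitrary map. -/

section General

variable {δ : Type*} {M : SurfaceMap δ}

open scoped Classical in
/-- The indicator function of the darts of an orientation. -/
def Orientation.ind (D : M.Orientation) (x : δ) : ℤ := if x ∈ D.darts then 1 else 0

theorem Orientation.ind_rev (D : M.Orientation) (x : δ) : D.ind (M.rev x) = 1 - D.ind x := by
  by_cases h : x ∈ D.darts <;> simp [ind, D.rev_mem_iff, h]

theorem Orientation.ind_injective : Function.Injective (Orientation.ind (M := M)) := by
  intro D D' h
  ext x
  have := congrFun h x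
  by_cases h1 : x ∈ D.darts <;> by_cases h2 : x ∈ D'.darts <;> simp_all [ind]

theorem Orientation.setFlow_sdiff (D D' : M.Orientation) (x : δ) :
    M.setFlow (D.darts \ D'.darts) x = D.ind x - D'.ind x := by
  by_cases h1 : x ∈ D.darts <;> by_cases h2 : x ∈ D'.darts <;>
    simp [setFlow, ind, D.rev_mem_iff, D'.rev_mem_iff, h1, h2]

theorem sum_smul_faceFlow [Finite δ] (c : M.Face → ℤ) (x : δ) :
    (∑ F, c F • M.faceFlow F) x = c (M.leftFace x) - c (M.leftFace (M.rev x)) := by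
  classical
  simp [Finset.sum_apply, faceFlow, setFlow, mul_sub, Finset.sum_sub_distrib]

/-- `h` is a height function for the pair `D`, `D'`: the flow of `D \ D'` is the combination of the
facial walks with the coefficients given by `h`. -/
def Orientation.IsHeight (D D' : M.Orientation) (h : M.Face → ℤ) : Prop :=
  ∀ x, D.ind x - D'.ind x = h (M.leftFace x) - h (M.leftFace (M.rev x))

theorem Orientation.faceLE_iff [Finite δ] (f₀ : M.Face) (D D' : M.Orientation) :
    D.FaceLE f₀ D' ↔ ∃ h, D.IsHeight D' h ∧ h f₀ = 0 ∧ ∀ F, 0 ≤ h F := by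
  constructor
  · rintro ⟨c, h0, hc⟩
    refine ⟨fun F => c F, fun x => ?_, by simp [h0], fun F => by positivity⟩
    rw [← setFlow_sdiff, hc, sum_smul_faceFlow fun F => (c F : ℤ)]
  · rintro ⟨h, hh, h0, hn⟩
    refine ⟨fun F => (h F).toNat, by simp [h0], ?_⟩
    ext x
    rw [setFlow_sdiff, hh, sum_smul_faceFlow fun F => ((h F).toNat : ℤ)]
    simp [hn]

theorem leftFace_rev_next (x : δ) : M.leftFace (M.rev (M.next x)) = M.leftFace x := by
  rw [← M.leftFace_faceNext, M.faceNext_rev_next]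

/-- The dual map is connected. -/
theorem eq_of_forall_leftFace_eq (h : M.Face → ℤ)
    (hh : ∀ x, h (M.leftFace x) = h (M.leftFace (M.rev x))) (F F' : M.Face) : h F = h F' := by
  induction F using Quotient.inductionOn with | _ a
  induction F' using Quotient.inductionOn with | _ b
  obtain ⟨g, hg, rfl⟩ := M.connected a b
  change h (M.leftFace a) = h (M.leftFace (g a))
  have key : ∀ x, h (M.leftFace x) = h (M.leftFace (g x)) := by
    induction hg using Subgroup.closure_induction with
    | mem g hg =>
      intro x
      rcases hg with rfl | rfl
      -- The face left of `x` is the face right of `next x`, so rotating about a vertex crosses one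
      -- edge.
      · rw [hh (M.next x), leftFace_rev_next]
      · exact hh x
    | one => exact fun x => rfl
    | mul g g' _ _ h1 h2 => exact fun x => (h2 x).trans (h1 (g' x))
    | inv g _ h1 =>
      intro x
      have := h1 (g⁻¹ x)
      rw [apply_inv_self] at this
      exact this.symm
  exact key a

theorem exists_face_function [Finite δ] (f : δ → ℤ) (hf : ∀ x, f (M.faceNext x) = f x) :
    ∃ h : M.Face → ℤ, ∀ x, h (M.leftFace x) = f x := by
  refine ⟨Quotient.lift f ?_, fun x => rfl⟩
  intro a b hab
  obtain ⟨n, -, rfl⟩ := Equiv.Perm.SameCycle.exists_pow_eq' hab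
  clear hab
  induction n with
  | zero => simp
  | succ n ih => rw [pow_succ', Equiv.Perm.mul_apply, hf, ih]

open scoped Classical in
theorem sum_leftFace_sub [Fintype δ] (K : δ → ℤ) (F : M.Face) :
    ∑ d with M.leftFace d = F, (K (M.faceNext d) - K d) = 0 := by
  rw [Finset.sum_sub_distrib, sub_eq_zero]
  exact Finset.sum_equiv M.faceNext (fun d => by simp [leftFace_faceNext]) (fun d _ => rfl)

open scoped Classical in
theorem Orientation.ncard_inter [Fintype δ] (D : M.Orientation) (S : Set δ) :
    ((D.darts ∩ S).ncard : ℤ) = ∑ x with x ∈ S, D.ind x := by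
  have : D.darts ∩ S = ↑(Finset.univ.filter fun x => x ∈ S ∧ x ∈ D.darts) := by
    ext x
    simp [and_comm]
  rw [this, Set.ncard_coe_finset, ← Finset.filter_filter, ← Finset.sum_boole]
  rfl

open scoped Classical in
theorem Orientation.outdegree_eq_sum [Fintype δ] (D : M.Orientation) (v : M.Vertex) :
    (D.outdegree v : ℤ) = ∑ x with M.tail x = v, D.ind x :=
  D.ncard_inter {x | M.tail x = v}

/-- Around a vertex the height changes telescope: the face right of `next x` is the face left of
`x`. -/
theorem Orientation.IsHeight.outdegree_eq [Finite δ] {D D' : M.Orientation} {h : M.Face → ℤ}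
    (hh : D.IsHeight D' h) (v : M.Vertex) : D.outdegree v = D'.outdegree v := by
  classical
  have := Fintype.ofFinite δ
  zify
  rw [outdegree_eq_sum, outdegree_eq_sum, ← sub_eq_zero, ← Finset.sum_sub_distrib]
  simp only [hh _]
  rw [Finset.sum_sub_distrib, sub_eq_zero]
  symm
  exact Finset.sum_equiv M.next.symm (fun x => by simp [← M.tail_next (M.next.symm x)])
    (fun x _ => by rw [← leftFace_rev_next (M.next.symm x), Equiv.apply_symm_apply])

/-- If the outdegrees of two orientations agree, then their difference has local potentials at the
vertices. -/
theorem Orientation.exists_vertex_local_potential [Finite δ] {D D' : M.Orientation}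
    (h : ∀ v, D.outdegree v = D'.outdegree v) :
    ∃ V : δ → ℤ, ∀ x, V (M.next x) - V x = D.ind (M.next x) - D'.ind (M.next x) := by
  classical
  have := Fintype.ofFinite δ
  -- `V x` plays the role of the height in the corner between `x` and `next x`; passing to the next
  -- corner crosses `next x`.
  refine (Equiv.Perm.sumZeroOnCycles_of_sum_sameCycle (σ := M.next)
    (f := fun x => D.ind (M.next x) - D'.ind (M.next x)) fun a => ?_).exists_potential
  have h1 := h (M.tail a)
  zify at h1
  rw [outdegree_eq_sum, outdegree_eq_sum, ← sub_eq_zero, ← Finset.sum_sub_distrib] at h1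
  rw [← h1]
  refine Finset.sum_equiv M.next (fun x => ?_) (fun x _ => rfl)
  simp only [Finset.mem_filter_univ, tail_next]
  exact ⟨fun hx => (Quotient.sound hx).symm, fun hx => Quotient.exact hx.symm⟩

-- The sector is a run of consecutive rotations of `a` ending just before the first arrival at `b`,
-- so the sum telescopes.
open scoped Classical in
theorem sum_sector [Fintype δ] (f V : δ → ℤ) (hV : ∀ x, V (M.next x) - V x = f (M.next x))
    {a b : δ} (hab : M.next.SameCycle a b) (hne : a ≠ b) :
    ∑ x with x ∈ M.sector a b, f x = V (M.next⁻¹ b) - V a := by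
  obtain ⟨k, hk, hmin⟩ : ∃ k, (M.next ^ (k + 1)) a = b ∧
      ∀ m, 0 < m → m ≤ k → (M.next ^ m) a ≠ b := by
    have hex : ∃ k, (M.next ^ k) a = b := by
      obtain ⟨k, -, hk⟩ := hab.exists_pow_eq'
      exact ⟨k, hk⟩
    have hpos : Nat.find hex ≠ 0 := fun h0 => hne (by simpa [h0] using Nat.find_spec hex)
    obtain ⟨k, hk⟩ := Nat.exists_eq_succ_of_ne_zero hpos
    refine ⟨k, ?_, fun m _ hm => Nat.find_min hex (by omega)⟩
    rw [← Nat.succ_eq_add_one, ← hk]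
    exact Nat.find_spec hex
  have hinj : Set.InjOn (fun n => (M.next ^ (n + 1)) a) (Finset.range k : Set ℕ) := by
    have aux : ∀ i j, i < j → j < k → (M.next ^ (i + 1)) a ≠ (M.next ^ (j + 1)) a := by
      intro i j hij hjk he
      -- A repetition inside the run could be cut out, reaching `b` too early.
      refine hmin (k + 1 - (j - i)) (by omega) (by omega) ?_
      have e1 : k + 1 - (j - i) = (k - j) + (i + 1) := by omega
      rw [e1, pow_add, Equiv.Perm.mul_apply, he, ← Equiv.Perm.mul_apply, ← pow_add,
        show k - j + (j + 1) = k + 1 by omega, hk]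
    intro i hi j hj hij
    simp only [Finset.coe_range, Set.mem_Iio] at hi hj
    rcases lt_trichotomy i j with h | h | h
    · exact absurd hij (aux i j h hj)
    · exact h
    · exact absurd hij.symm (aux j i h hi)
  have himg : (Finset.univ.filter fun x => x ∈ M.sector a b) =
      (Finset.range k).image fun n => (M.next ^ (n + 1)) a := by
    ext x
    rw [Finset.mem_filter_univ, Finset.mem_image]
    simp only [Finset.mem_range]
    constructor
    · rintro ⟨n, hn, rfl, hb⟩
      refine ⟨n - 1, ?_, by rw [Nat.sub_add_cancel hn]⟩
      by_contra hlt
      exact hb (k + 1) (by omega) (by omega) hk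
    · rintro ⟨n, hn, rfl⟩
      exact ⟨n + 1, by omega, rfl, fun m hm hmn => hmin m hm (by omega)⟩
  rw [himg, Finset.sum_image hinj]
  have hstep : ∀ n, f ((M.next ^ (n + 1)) a) =
      V ((M.next ^ (n + 1)) a) - V ((M.next ^ n) a) := by
    intro n
    rw [pow_succ', Equiv.Perm.mul_apply, hV]
  simp only [hstep]
  rw [Finset.sum_range_sub fun n => V ((M.next ^ n) a), ← hk, pow_succ']
  simp

/-- Both sectors telescope; what remains is `V` at the two corners flanking `a` minus `V` at the two
flanking `b`. -/
theorem Orientation.turn_sub_turn [Finite δ] {D D' : M.Orientation} (V : δ → ℤ)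
    (hV : ∀ x, V (M.next x) - V x = D.ind (M.next x) - D'.ind (M.next x))
    {a b : δ} (hab : M.next.SameCycle a b) (hne : a ≠ b) :
    D.turn b a - D'.turn b a = V (M.next⁻¹ a) + V a - (V (M.next⁻¹ b) + V b) := by
  classical
  have := Fintype.ofFinite δ
  have h1 := sum_sector (fun x => D.ind x - D'.ind x) V hV hab hne
  have h2 := sum_sector (fun x => D.ind x - D'.ind x) V hV hab.symm hne.symm
  rw [Finset.sum_sub_distrib] at h1 h2
  simp only [turn, ncard_inter]
  linarith

end General

/-! ### Heights and γ on the primal-dual completion. -/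

section Completion

open PDart

variable {δ : Type*} {G : SurfaceMap δ}

@[simp] theorem pdc_next_primal (d : δ) : G.pdc.next (primal d) = primal (G.next d) := rfl
@[simp] theorem pdc_next_dual (d : δ) : G.pdc.next (dual d) = dual (G.faceNext d) := rfl
@[simp] theorem pdc_next_toPrimal (d : δ) : G.pdc.next (toPrimal d) = toDual (G.rev d) := rfl
@[simp] theorem pdc_next_toDual (d : δ) : G.pdc.next (toDual d) = toPrimal d := rfl
@[simp] theorem pdc_rev_primal (d : δ) : G.pdc.rev (primal d) = toPrimal d := rfl
@[simp] theorem pdc_rev_dual (d : δ) : G.pdc.rev (dual d) = toDual d := rfl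

theorem pdc_next_inv_primal (d : δ) : G.pdc.next⁻¹ (primal d) = primal (G.next⁻¹ d) := rfl

theorem pdc_next_inv_toPrimal (d : δ) : G.pdc.next⁻¹ (toPrimal d) = toDual d := rfl

theorem pdc_faceNext_primal (d : δ) : G.pdc.faceNext (primal d) = toDual d := rfl
theorem pdc_faceNext_dual (d : δ) : G.pdc.faceNext (dual d) = toPrimal (G.rev d) := rfl
theorem pdc_faceNext_toPrimal (d : δ) :
    G.pdc.faceNext (toPrimal d) = primal (G.next⁻¹ d) := rfl
theorem pdc_faceNext_toDual (d : δ) :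
    G.pdc.faceNext (toDual d) = dual (G.faceNext⁻¹ d) := rfl

theorem leftFace_toDual (d : δ) : G.pdc.leftFace (toDual d) = G.pdc.leftFace (primal d) := by
  rw [← pdc_faceNext_primal, leftFace_faceNext]

theorem leftFace_toPrimal (d : δ) :
    G.pdc.leftFace (toPrimal d) = G.pdc.leftFace (primal (G.next⁻¹ d)) := by
  rw [← pdc_faceNext_toPrimal, leftFace_faceNext]

theorem leftFace_dual (d : δ) :
    G.pdc.leftFace (dual d) = G.pdc.leftFace (primal (G.faceNext d)) := by
  rw [← leftFace_faceNext, pdc_faceNext_dual, leftFace_toPrimal]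
  rfl

/-- A function on angles gives a function on the faces of the primal-dual completion. -/
theorem exists_pdc_face_function [Finite δ] (lam : δ → ℤ) :
    ∃ h : G.pdc.Face → ℤ, ∀ d, h (G.pdc.leftFace (primal d)) = lam d := by
  obtain ⟨h, hh⟩ := exists_face_function (M := G.pdc)
    -- The face at angle `d` is a quadrilateral with boundary darts `primal d`, `toDual d`, `dual
    -- (faceNext⁻¹ d)`, `toPrimal (next d)`; each of them receives the value `lam d`.
    (fun
      | primal d => lam d
      | toDual d => lam d
      | dual d => lam (G.faceNext d)
      | toPrimal d => lam (G.next⁻¹ d))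
    (by
      rintro (d | d | d | d)
      · rw [pdc_faceNext_primal]
      · rw [pdc_faceNext_dual]
        rfl
      · rw [pdc_faceNext_toPrimal]
      · rw [pdc_faceNext_toDual]
        simp)
  exact ⟨h, fun d => hh _⟩

/-- In terms of angles, a height function is a function on the angles with prescribed changes across
the edges of the primal-dual completion. -/
theorem isHeight_iff {D D' : G.pdc.Orientation} {h : G.pdc.Face → ℤ} {lam : δ → ℤ}
    (hl : ∀ d, h (G.pdc.leftFace (primal d)) = lam d) :
    D.IsHeight D' h ↔
      (∀ d, D.ind (primal d) - D'.ind (primal d) = lam d - lam (G.next⁻¹ d)) ∧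
      (∀ d, D.ind (dual d) - D'.ind (dual d) = lam (G.faceNext d) - lam d) := by
  have hrev : ∀ x : PDart δ, (D.ind x - D'.ind x =
      h (G.pdc.leftFace x) - h (G.pdc.leftFace (G.pdc.rev x))) →
      D.ind (G.pdc.rev x) - D'.ind (G.pdc.rev x) =
        h (G.pdc.leftFace (G.pdc.rev x)) - h (G.pdc.leftFace (G.pdc.rev (G.pdc.rev x))) := by
    intro x hx
    rw [D.ind_rev, D'.ind_rev, G.pdc.rev_rev]
    linarith
  constructor
  · intro H
    refine ⟨fun d => ?_, fun d => ?_⟩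
    · rw [H, pdc_rev_primal, leftFace_toPrimal, hl, hl]
    · rw [H, pdc_rev_dual, leftFace_toDual, leftFace_dual, hl, hl]
  · rintro ⟨H1, H2⟩
    have hp : ∀ d, D.ind (primal d) - D'.ind (primal d) =
        h (G.pdc.leftFace (primal d)) - h (G.pdc.leftFace (G.pdc.rev (primal d))) := fun d => by
      rw [pdc_rev_primal, leftFace_toPrimal, hl, hl, H1]
    have hd : ∀ d, D.ind (dual d) - D'.ind (dual d) =
        h (G.pdc.leftFace (dual d)) - h (G.pdc.leftFace (G.pdc.rev (dual d))) := fun d => by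
      rw [pdc_rev_dual, leftFace_toDual, leftFace_dual, hl, hl, H2]
    rintro (d | d | d | d)
    · exact hp d
    · exact hd d
    · exact hrev _ (hp d)
    · exact hrev _ (hd d)

/-- For a local potential `V` at the vertices of the difference of `D` and `D'`, the function on the
darts of `G` that remains to be integrated to obtain a height function. -/
def residualForm (D D' : G.pdc.Orientation) (V : PDart δ → ℤ) (d : δ) : ℤ :=
  D.ind (dual d) - D'.ind (dual d) + V (primal d) - V (primal (G.faceNext d))

/-- By the increments of `V` at the two ends of `d`, the sum of the residual form at `d` and `rev d`
is the total difference of `D` and `D'` over the four edges at the edge-vertex. It vanishes because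
`V` returns to its value after a full turn there. The second relation compares the two steps across
the dual edge. -/
theorem residualForm_relations {D D' : G.pdc.Orientation} {V : PDart δ → ℤ}
    (hV : ∀ x, V (G.pdc.next x) - V x = D.ind (G.pdc.next x) - D'.ind (G.pdc.next x)) (d : δ) :
    residualForm D D' V (G.rev d) = -residualForm D D' V d ∧
    V (toDual (G.rev d)) + V (toPrimal (G.rev d)) - (V (toDual d) + V (toPrimal d)) =
      D.ind (dual d) - D'.ind (dual d) -
        (D.ind (dual (G.rev d)) - D'.ind (dual (G.rev d))) := by
  have e1 := hV (toPrimal d)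
  have e2 := hV (toDual (G.rev d))
  have e3 := hV (toPrimal (G.rev d))
  have e4 := hV (toDual d)
  have e5 := hV (primal (G.next⁻¹ d))
  have e6 := hV (primal (G.faceNext d))
  have r1 := fun d => D.ind_rev (primal d)
  have r2 := fun d => D.ind_rev (dual d)
  have r1' := fun d => D'.ind_rev (primal d)
  have r2' := fun d => D'.ind_rev (dual d)
  simp only [pdc_next_primal, pdc_next_toPrimal, pdc_next_toDual, pdc_rev_primal, pdc_rev_dual,
    G.rev_rev, G.next_faceNext, apply_inv_self] at e1 e2 e3 e4 e5 e6 r1 r2 r1' r2'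
  rw [r2, r2'] at e1 e3
  rw [r1, r1'] at e2 e4
  simp only [residualForm, G.faceNext_rev]
  constructor <;> linarith

/-- The difference of the values of `γ` for two orientations with the same outdegrees is twice the
sum over the cycle of an antisymmetric function. -/
theorem gamma_sub_gamma [Finite δ] {D D' : G.pdc.Orientation} (V : PDart δ → ℤ)
    (hV : ∀ x, V (G.pdc.next x) - V x = D.ind (G.pdc.next x) - D'.ind (G.pdc.next x))
    (C : G.DirCycle) :
    gamma D C - gamma D' C = 2 * ∑ i, residualForm D D' V (C.dart i) := by
  have hturn1 : ∀ i, D.turn (primal (G.rev (C.dart i))) (primal (C.dart (finRotate C.length i))) -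
      D'.turn (primal (G.rev (C.dart i))) (primal (C.dart (finRotate C.length i))) =
      (V (primal (G.next⁻¹ (C.dart (finRotate C.length i)))) +
        V (primal (C.dart (finRotate C.length i)))) -
      (V (primal (G.faceNext (C.dart i))) + V (primal (G.rev (C.dart i)))) := by
    intro i
    have hsame : G.pdc.next.SameCycle (primal (C.dart (finRotate C.length i)))
        (primal (G.rev (C.dart i))) := by
      have h1 : G.next.SameCycle (C.dart (finRotate C.length i)) (G.rev (C.dart i)) :=
        Quotient.exact (C.closed i).symm
      obtain ⟨n, -, hn⟩ := h1.exists_pow_eq'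
      refine ⟨n, ?_⟩
      rw [← hn, zpow_natCast]
      clear hn
      induction n with
      | zero => rfl
      | succ n ih => rw [pow_succ', Equiv.Perm.mul_apply, ih, pow_succ', Equiv.Perm.mul_apply]; rfl
    have hne : primal (C.dart (finRotate C.length i)) ≠ primal (G.rev (C.dart i)) := by
      intro h
      exact C.ne_rev _ _ (PDart.primal.inj h)
    rw [Orientation.turn_sub_turn V hV hsame hne, pdc_next_inv_primal, pdc_next_inv_primal]
    rfl
  have hturn2 : ∀ d, D.turn (toPrimal d) (toPrimal (G.rev d)) -
      D'.turn (toPrimal d) (toPrimal (G.rev d)) =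
      V (toDual (G.rev d)) + V (toPrimal (G.rev d)) - (V (toDual d) + V (toPrimal d)) := by
    intro d
    -- The two halves of an edge are opposite at its edge-vertex, two rotations apart.
    rw [Orientation.turn_sub_turn V hV ⟨2, ?_⟩, pdc_next_inv_toPrimal, pdc_next_inv_toPrimal]
    · intro h
      exact G.rev_ne d (PDart.toPrimal.inj h)
    · rw [zpow_ofNat, pow_two, Equiv.Perm.mul_apply]
      simp [G.rev_rev]
  -- Shifting the terms of the outgoing darts by one index collects, for each dart `d` of the cycle,
  -- the corners at both of its ends. With the edge-vertex term they give the residual form at `d`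
  -- minus that at `rev d`, which is twice its value at `d`.
  have hsum := Equiv.sum_comp (finRotate C.length) fun i =>
    V (primal (G.next⁻¹ (C.dart i))) + V (primal (C.dart i))
  rw [gamma, gamma, ← Finset.sum_sub_distrib]
  have hterm : ∀ i, D.turn (primal (G.rev (C.dart i))) (primal (C.dart (finRotate C.length i))) +
      D.turn (toPrimal (C.dart i)) (toPrimal (G.rev (C.dart i))) -
      (D'.turn (primal (G.rev (C.dart i))) (primal (C.dart (finRotate C.length i))) +
      D'.turn (toPrimal (C.dart i)) (toPrimal (G.rev (C.dart i)))) =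
      (V (primal (G.next⁻¹ (C.dart (finRotate C.length i)))) +
        V (primal (C.dart (finRotate C.length i)))) +
      (2 * residualForm D D' V (C.dart i) -
        (V (primal (G.next⁻¹ (C.dart i))) + V (primal (C.dart i)))) := by
    intro i
    rw [add_sub_add_comm, hturn1, hturn2]
    generalize C.dart i = d
    obtain ⟨e1, e2⟩ := residualForm_relations hV d
    simp only [residualForm, G.faceNext_rev] at e1 ⊢
    linarith
  rw [Finset.sum_congr rfl fun i _ => hterm i, Finset.sum_add_distrib, hsum,
    Finset.sum_sub_distrib, ← Finset.mul_sum]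
  ring

/-- A global height is itself a local potential, and its residual form is zero. -/
theorem Orientation.IsHeight.gamma_eq [Finite δ] {D D' : G.pdc.Orientation} {h : G.pdc.Face → ℤ}
    (hh : D.IsHeight D' h) (C : G.DirCycle) : gamma D C = gamma D' C := by
  rw [← sub_eq_zero, gamma_sub_gamma (fun x => h (G.pdc.leftFace x))
    (fun x => by rw [hh, leftFace_rev_next])]
  simp [residualForm, hh (dual _), leftFace_dual, leftFace_toDual]

/-- Two orientations with the same outdegrees and the same type are homologous. -/
theorem exists_isHeight [Finite δ] {g : ℕ} {B : Fin (2 * g) → G.DirCycle}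
    (hB : G.IsHomologyBasis B) {D D' : G.pdc.Orientation}
    (hout : ∀ v, D.outdegree v = D'.outdegree v)
    (htype : ∀ i, gamma D (B i) = gamma D' (B i)) : ∃ h, D.IsHeight D' h := by
  classical
  have := Fintype.ofFinite δ
  obtain ⟨V, hV⟩ := Orientation.exists_vertex_local_potential hout
  set ω := residualForm D D' V with hω
  have hanti : ∀ d, ω (G.rev d) = -ω d := fun d => (residualForm_relations hV d).1
  have hface : ∀ F, ∑ d, G.faceFlow F d * ω d = 0 := by
    intro F
    -- By the local potential at the dual-vertex, `ω` is an increment along `faceNext`, so it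
    -- telescopes around the face.
    rw [G.sum_faceFlow_mul F ω hanti, ← mul_zero 2,
      ← sum_leftFace_sub (fun d => V (dual (G.faceNext⁻¹ d)) - V (primal d)) F]
    congr 1
    refine Finset.sum_congr rfl fun d _ => ?_
    have := hV (dual (G.faceNext⁻¹ d))
    simp only [pdc_next_dual, apply_inv_self] at this
    simp only [hω, residualForm, inv_apply_self]
    linarith
  have hcyc : ∀ i, ∑ j, ω ((B i).dart j) = 0 := by
    intro i
    have h1 := gamma_sub_gamma V hV (B i)
    rw [htype, sub_self, ← hω] at h1
    omega
  obtain ⟨μ, hμ⟩ := G.exists_vertex_potential ω hanti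
    (G.sum_mul_eq_zero_of_mem_closedWalkGroup hB ω hanti hface hcyc)
  -- The values of `V` at the corners of one vertex are all shifted by `μ`; as `ω` is the coboundary
  -- of `μ`, the shifted values fit across the dual edges.
  obtain ⟨h, hh⟩ := exists_pdc_face_function (G := G) fun d => V (primal d) + μ (G.tail d)
  refine ⟨h, (isHeight_iff hh).2 ⟨fun d => ?_, fun d => ?_⟩⟩
  · have h1 := hV (primal (G.next⁻¹ d))
    have h2 := G.tail_next (G.next⁻¹ d)
    simp only [pdc_next_primal, apply_inv_self] at h1 h2
    rw [h2]
    linarith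
  · have h1 := hμ d
    rw [head, ← G.next_faceNext, G.tail_next] at h1
    simp only [hω, residualForm] at h1
    linarith

/-! ### Schnyder labelings as heights mod 3. -/

-- Four steps in {0, 1} around an edge sum to 0 mod 3, so none or exactly three of them are 1. The
-- position of the only zero step distinguishes types 1 and 2 and the direction of the edge.
set_option synthInstance.maxSize 2000 in
set_option synthInstance.maxHeartbeats 200000 in
theorem zmod_three_cases : ∀ x z y w : ZMod 3, (z - x = 0 ∨ z - x = 1) → (y - z = 0 ∨ y - z = 1) →
    (w - y = 0 ∨ w - y = 1) → (x - w = 0 ∨ x - w = 1) →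
    (z = x ∧ y = x ∧ w = x) ∨ (y = x - 1 ∧ w = x ∧ z = x + 1) ∨ (x = y - 1 ∧ z = y ∧ w = y + 1) ∨
      (w = x - 1 ∧ z = x ∧ y = x + 1) ∨ (z = y - 1 ∧ w = y ∧ x = y + 1) := by
  decide

/-- An orientation is a Schnyder orientation if and only if there is a labeling of the angles that
changes by one, clockwise around each edge-vertex, across exactly the incoming edges. -/
theorem isSchnyder_iff {D : G.pdc.Orientation} :
    G.IsSchnyder D ↔ ∃ l : δ → ZMod 3,
      (∀ d, l (G.faceNext d) - l d = (D.ind (dual d) : ZMod 3)) ∧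
      (∀ d, l d - l (G.next⁻¹ d) = (D.ind (primal d) : ZMod 3)) := by
  have hp : ∀ d, toPrimal d ∈ D.darts ↔ primal d ∉ D.darts := fun d => D.rev_mem_iff (primal d)
  have hd : ∀ d, toDual d ∈ D.darts ↔ dual d ∉ D.darts := fun d => D.rev_mem_iff (dual d)
  constructor
  · rintro ⟨l, hl, hc⟩
    -- The clockwise step from label `i + 1` back to `i - 1` is -2, which is 1 mod 3.
    have three : (3 : ZMod 3) = 0 := rfl
    have key : ∀ d, l (G.faceNext d) - l d = (D.ind (dual d) : ZMod 3) ∧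
        l d - l (G.next⁻¹ d) = (D.ind (primal d) : ZMod 3) := by
      intro d
      obtain ⟨c0, c1, c2⟩ := hc d
      obtain ⟨-, c1', c2'⟩ := hc (G.rev d)
      simp only [hp, hd, not_not, G.rev_rev] at c0 c1 c2 c1' c2'
      rw [← G.faceNext_rev]
      rcases hl d with t | (t | t) | (t | t)
      · obtain ⟨h1, h2, h3, h4⟩ := c0 t
        obtain ⟨i, t1, t2, t3, t4⟩ := t
        simp [Orientation.ind, *]
      · obtain ⟨h1, h2, h3, h4⟩ := c1 t
        obtain ⟨i, t1, t2, t3, t4⟩ := t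
        simp [Orientation.ind, *]
      · obtain ⟨h1, h2, h3, h4⟩ := c1' t
        obtain ⟨i, t1, t2, t3, t4⟩ := t
        rw [G.rev_rev] at t1 t2
        simp only [Orientation.ind, *, if_true, Int.cast_one]
        refine ⟨by ring, ?_⟩
        linear_combination -three
      · obtain ⟨h1, h2, h3, h4⟩ := c2 t
        obtain ⟨i, t1, t2, t3, t4⟩ := t
        simp [Orientation.ind, *]
      · obtain ⟨h1, h2, h3, h4⟩ := c2' t
        obtain ⟨i, t1, t2, t3, t4⟩ := t
        rw [G.rev_rev] at t1 t4
        simp only [Orientation.ind, *, if_true, Int.cast_one]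
        refine ⟨?_, by ring⟩
        linear_combination -three
    exact ⟨l, fun d => (key d).1, fun d => (key d).2⟩
  · rintro ⟨l, h1, h2⟩
    have hstep : ∀ x, (D.ind x : ZMod 3) = 0 ∨ (D.ind x : ZMod 3) = 1 := fun x => by
      by_cases h : x ∈ D.darts <;> simp [Orientation.ind, h]
    have hmem : ∀ x, (D.ind x : ZMod 3) = 1 → x ∈ D.darts := fun x hx => by
      by_contra h
      simp [Orientation.ind, h] at hx
    have hnot : ∀ x, (D.ind x : ZMod 3) = 0 → x ∉ D.darts := fun x hx h => by
      simp [Orientation.ind, h] at hx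
    have neg_two : ∀ i : ZMod 3, i - 1 - (i + 1) = 1 := by decide
    refine ⟨l, fun d => ?_, fun d => ?_⟩
    all_goals
      have a1 := h1 d
      have a2 := h2 (G.rev d)
      have a3 := h1 (G.rev d)
      have a4 := h2 d
      rw [← G.faceNext_rev, G.rev_rev] at a2
      rw [← G.faceNext_rev] at a4
    · have := zmod_three_cases (l d) (l (G.faceNext d)) (l (G.rev d)) (l (G.faceNext (G.rev d)))
        (a1 ▸ hstep _) (a2 ▸ hstep _) (a3 ▸ hstep _) (a4 ▸ hstep _)
      simp only [EdgeType0, EdgeType1, EdgeType2, G.rev_rev]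
      rcases this with ⟨t1, t2, t3⟩ | ⟨t1, t2, t3⟩ | ⟨t1, t2, t3⟩ | ⟨t1, t2, t3⟩ | ⟨t1, t2, t3⟩
      · exact .inl ⟨_, rfl, t1, t2, t3⟩
      · exact .inr (.inl (.inl ⟨_, t1, t2, rfl, t3⟩))
      · exact .inr (.inl (.inr ⟨_, t1, t2, rfl, t3⟩))
      · exact .inr (.inr (.inl ⟨_, t1, rfl, t2, t3⟩))
      · exact .inr (.inr (.inr ⟨_, t1, rfl, t2, t3⟩))
    · simp only [hp, hd, not_not]
      refine ⟨?_, ?_, ?_⟩ <;> rintro ⟨i, t1, t2, t3, t4⟩ <;>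
        simp only [t1, t2, t3, t4, sub_self, add_sub_cancel_left, sub_sub_cancel, neg_two]
          at a1 a2 a3 a4
      · exact ⟨hnot _ a4.symm, hnot _ a2.symm, hnot _ a1.symm, hnot _ a3.symm⟩
      · exact ⟨hnot _ a4.symm, hmem _ a2.symm, hmem _ a1.symm, hmem _ a3.symm⟩
      · exact ⟨hmem _ a4.symm, hmem _ a2.symm, hnot _ a1.symm, hmem _ a3.symm⟩

/-- Subtracting the height mod 3 from the labels changes each step by exactly the difference of the
two indicators. -/
theorem IsSchnyder.of_isHeight {D D' : G.pdc.Orientation} {h : G.pdc.Face → ℤ}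
    (hD : G.IsSchnyder D) (hh : D.IsHeight D' h) : G.IsSchnyder D' := by
  rw [isSchnyder_iff] at hD ⊢
  obtain ⟨l, h1, h2⟩ := hD
  obtain ⟨e1, e2⟩ := (isHeight_iff fun d => rfl).1 hh
  refine ⟨fun d => l d - (h (G.pdc.leftFace (primal d)) : ℤ), fun d => ?_, fun d => ?_⟩
  · have := congrArg (Int.cast : ℤ → ZMod 3) (e2 d)
    push_cast at this
    linear_combination h1 d + this
  · have := congrArg (Int.cast : ℤ → ZMod 3) (e1 d)
    push_cast at this
    linear_combination h2 d + this

theorem mem_schnyderClass_iff [Finite δ] {g : ℕ} {B : Fin (2 * g) → G.DirCycle}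
    (hB : G.IsHomologyBasis B) {D₀ : G.pdc.Orientation} (hD₀ : G.IsSchnyder D₀)
    (D : G.pdc.Orientation) : D ∈ G.schnyderClass B D₀ ↔ ∃ h, D₀.IsHeight D h := by
  constructor
  · rintro ⟨-, hout, htype⟩
    exact exists_isHeight hB (fun v => (hout v).symm) fun i => (htype i).symm
  · rintro ⟨h, hh⟩
    exact ⟨hD₀.of_isHeight hh, fun v => (hh.outdegree_eq v).symm, fun i => (hh.gamma_eq _).symm⟩

end Completion

end SurfaceMap
end
noncomputable section

/-! ### The lattice of normalized heights. -/

namespace SurfaceMap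

variable {δ : Type*} {M : SurfaceMap δ}

namespace Orientation

theorem ind_nonneg (D : M.Orientation) (x : δ) : 0 ≤ D.ind x := by
  unfold ind
  split_ifs <;> simp

/-- The bound at `rev x` is the lower bound at `x`. Together they force the indicator of `D₀` minus
the change of `h` into {0, 1}, so it is the indicator of an orientation. -/
theorem exists_isHeight_iff (D₀ : M.Orientation) (h : M.Face → ℤ) :
    (∃ D, D₀.IsHeight D h) ↔
      ∀ x, h (M.leftFace x) - h (M.leftFace (M.rev x)) ≤ D₀.ind x := by
  constructor
  · rintro ⟨D, hD⟩ x
    have := hD x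
    have := D.ind_nonneg x
    linarith
  · intro H
    have h01 : ∀ x, D₀.ind x - (h (M.leftFace x) - h (M.leftFace (M.rev x))) = 0 ∨
        D₀.ind x - (h (M.leftFace x) - h (M.leftFace (M.rev x))) = 1 := by
      intro x
      have h1 := H x
      have h2 := H (M.rev x)
      rw [D₀.ind_rev, M.rev_rev] at h2
      omega
    refine ⟨⟨{x | D₀.ind x - (h (M.leftFace x) - h (M.leftFace (M.rev x))) = 1}, fun x => ?_⟩,
      fun x => ?_⟩
    · simp only [Set.mem_ofPred_eq, D₀.ind_rev, M.rev_rev]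
      have := h01 x
      omega
    · have := h01 x
      unfold ind at this ⊢
      simp only [Set.mem_ofPred_eq]
      split_ifs at * <;> omega

/-- Two heights of the same pair differ by a constant, the dual map being connected. -/
theorem IsHeight.unique {D₀ D : M.Orientation} {h k : M.Face → ℤ} {f₀ : M.Face}
    (hh : D₀.IsHeight D h) (hk : D₀.IsHeight D k) (h0 : h f₀ = k f₀) : h = k := by
  have := eq_of_forall_leftFace_eq (M := M) (fun F => h F - k F) fun x => by
    have h1 := hh x
    have h2 := hk x
    linarith
  ext F
  have := this F f₀
  linarith

theorem IsHeight.eq_right {D₀ D D' : M.Orientation} {h : M.Face → ℤ}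
    (hD : D₀.IsHeight D h) (hD' : D₀.IsHeight D' h) : D = D' := by
  apply ind_injective
  ext x
  have h1 := hD x
  have h2 := hD' x
  linarith

theorem IsHeight.sub {D₀ D D' : M.Orientation} {h k : M.Face → ℤ}
    (hh : D₀.IsHeight D h) (hk : D₀.IsHeight D' k) : D.IsHeight D' (fun F => k F - h F) := by
  intro x
  have h1 := hh x
  have h2 := hk x
  linarith

theorem IsHeight.add_const {D₀ D : M.Orientation} {h : M.Face → ℤ} (hh : D₀.IsHeight D h) (n : ℤ) :
    D₀.IsHeight D (fun F => h F + n) := by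
  intro x
  have h1 := hh x
  linarith

/-- For heights vanishing at `f₀`, the order given by `f₀` is the pointwise order. -/
theorem IsHeight.faceLE_iff [Finite δ] {D₀ D D' : M.Orientation} {h k : M.Face → ℤ} {f₀ : M.Face}
    (hh : D₀.IsHeight D h) (h0 : h f₀ = 0) (hk : D₀.IsHeight D' k) (k0 : k f₀ = 0) :
    D.FaceLE f₀ D' ↔ h ≤ k := by
  rw [Orientation.faceLE_iff]
  constructor
  · rintro ⟨c, hc, c0, hn⟩ F
    have := congrFun (hc.unique (f₀ := f₀) (hh.sub hk) (by simp [c0, h0, k0])) F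
    have := hn F
    simp_all
  · intro hle
    exact ⟨_, hh.sub hk, by simp [h0, k0], fun F => sub_nonneg.2 (hle F)⟩

end Orientation

/-- The heights relative to `D₀` of the orientations homologous to `D₀`, normalized at `f₀`. -/
def heightSublattice (D₀ : M.Orientation) (f₀ : M.Face) : Sublattice (M.Face → ℤ) where
  carrier := {h | h f₀ = 0 ∧ ∀ x, h (M.leftFace x) - h (M.leftFace (M.rev x)) ≤ D₀.ind x}
  supClosed' := by
    rintro h ⟨h0, hh⟩ k ⟨k0, hk⟩
    refine ⟨by simp [h0, k0], fun x => ?_⟩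
    have h1 := hh x
    have h2 := hk x
    -- A common upper bound on two differences also bounds the difference of the maxima, and
    -- likewise of the minima.
    simp only [Pi.sup_apply]
    omega
  infClosed' := by
    rintro h ⟨h0, hh⟩ k ⟨k0, hk⟩
    refine ⟨by simp [h0, k0], fun x => ?_⟩
    have h1 := hh x
    have h2 := hk x
    simp only [Pi.inf_apply]
    omega

theorem mem_heightSublattice {D₀ : M.Orientation} {f₀ : M.Face} {h : M.Face → ℤ} :
    h ∈ heightSublattice D₀ f₀ ↔ h f₀ = 0 ∧ ∃ D, D₀.IsHeight D h := by
  rw [D₀.exists_isHeight_iff]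
  rfl

/-- Every set consisting of the orientations homologous to `D₀` is a distributive lattice. -/
theorem exists_distribLattice_faceLE [Finite δ] (D₀ : M.Orientation) (f₀ : M.Face)
    (S : Set M.Orientation) (hS : ∀ D, D ∈ S ↔ ∃ h, D₀.IsHeight D h) :
    ∃ L : DistribLattice S, ∀ D D' : S, L.le D D' ↔ D.1.FaceLE f₀ D'.1 := by
  have hex : ∀ D : S, ∃ h : heightSublattice D₀ f₀, D₀.IsHeight D.1 h.1 := by
    rintro ⟨D, hD⟩
    obtain ⟨h, hh⟩ := (hS D).1 hD
    -- Heights matter only up to constants, so the value at `f₀` can be made 0.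
    have hn := hh.add_const (-h f₀)
    exact ⟨⟨_, mem_heightSublattice.2 ⟨by simp, D, hn⟩⟩, hn⟩
  choose height hheight using hex
  have hbij : Function.Bijective height := by
    constructor
    · intro D D' he
      have h1 := hheight D'
      rw [← he] at h1
      exact Subtype.ext ((hheight D).eq_right h1)
    · rintro ⟨h, hh⟩
      obtain ⟨h0, D, hD⟩ := mem_heightSublattice.1 hh
      refine ⟨⟨D, (hS D).2 ⟨h, hD⟩⟩, Subtype.ext ?_⟩
      refine (hheight _).unique (f₀ := f₀) hD ?_
      exact Eq.trans (mem_heightSublattice.1 (Subtype.prop _)).1 h0.symm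
  let e : S ≃ heightSublattice D₀ f₀ := Equiv.ofBijective height hbij
  let _ : Max S := ⟨fun a b => e.symm (e a ⊔ e b)⟩
  let _ : Min S := ⟨fun a b => e.symm (e a ⊓ e b)⟩
  let _ : LE S := ⟨fun a b => e a ≤ e b⟩
  let _ : LT S := ⟨fun a b => e a < e b⟩
  refine ⟨Function.Injective.distribLattice e e.injective Iff.rfl Iff.rfl
    (fun a b => e.apply_symm_apply _) (fun a b => e.apply_symm_apply _), fun D D' => ?_⟩
  exact ((hheight D).faceLE_iff (mem_heightSublattice.1 (height D).2).1 (hheight D')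
    (mem_heightSublattice.1 (height D').2).1).symm

end SurfaceMap
end

/-- Schnyder orientations of the primal-dual completion with the same outdegrees and the same type
as `D₀` form a distributive lattice under the order given by the face `f₀`. -/
theorem theorem4p14 {δ : Type*} [Finite δ] (G : SurfaceMap δ) (g : ℕ) (hg : G.HasGenus g)
    (B : Fin (2 * g) → G.DirCycle) (hB : G.IsHomologyBasis B)
    (D₀ : G.pdc.Orientation) (hD₀ : G.IsSchnyder D₀) (f₀ : G.pdc.Face) :
    ∃ L : DistribLattice (G.schnyderClass B D₀),
      ∀ D D' : G.schnyderClass B D₀, L.le D D' ↔ D.1.FaceLE f₀ D'.1 :=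
  SurfaceMap.exists_distribLattice_faceLE D₀ f₀ _
    (SurfaceMap.mem_schnyderClass_iff hB hD₀)
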